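/- Let $0<r<1$ and let $\mathbb{A}_r=\{z\in\mathbb{C} : r<|z|<1\}$, with closure $\overline{\mathbb{A}}_r$ and boundary $\partial\mathbb{A}_r$. A bounded operator $U$ on a complex Hilbert space is an $\mathbb{A}_r$-unitary if $U$ is normal and $\sigma(U)\subseteq\partial\mathbb{A}_r$. A bounded operator $V$ on a complex Hilbert space $\mathcal{H}$ is an $\mathbb{A}_r$-isometry if $\sigma(V)\subseteq\overline{\mathbb{A}}_r$ and there are a Hilbert space $\mathcal{K}\supseteq\mathcal{H}$ and an $\mathbb{A}_r$-unitary $U$ on $\mathcal{K}$ such that $\mathcal{H}$ is invariant under $U$ and $U|_{\mathcal{H}}=V$. Theorem. Let $V$ be an invertible bounded operator on a complex Hilbert space $\mathcal{H}$. Then $V$ is an $\mathbb{A}_r$-isometry if and only if $$-V^{*2}V^2+(1+r^2)V^*V-r^2I=0,$$ or, equivalently, if and only if $$V^*V+(rV^{-1})^*(rV^{-1})=(1+r^2)I.$$ -/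

import Mathlib

/-- The open annulus of inner radius `r` and outer radius `1` in the complex plane. -/
def annulus (r : ℝ) : Set ℂ :=
  {z : ℂ | r < ‖z‖ ∧ ‖z‖ < 1}

/-- A bounded operator on a complex Hilbert space is an annulus unitary if it is normal and its
spectrum lies in the boundary of the annulus. -/
def IsAnnulusUnitary {K : Type*} [NormedAddCommGroup K] [InnerProductSpace ℂ K]
    [CompleteSpace K] (r : ℝ) (U : K →L[ℂ] K) : Prop :=
  IsStarNormal U ∧ spectrum ℂ U ⊆ frontier (annulus r)

/-- A bounded operator `V` on a complex Hilbert space `H` is an annulus isometry if its spectrum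
lies in the closed annulus and `V` is the restriction to `H` of an annulus unitary `U` on a Hilbert
space `K` containing `H` as an invariant subspace. The inclusion of `H` in `K` is the linear
isometry `ι`; the equation `U (ι h) = ι (V h)` says that the image of `H` is invariant under `U`
and that `U` restricts to `V` there. -/
def IsAnnulusIsometry.{u} {H : Type u} [NormedAddCommGroup H] [InnerProductSpace ℂ H]
    [CompleteSpace H] (r : ℝ) (V : H →L[ℂ] H) : Prop :=
  spectrum ℂ V ⊆ closure (annulus r) ∧
    ∃ (K : Type u) (_ : NormedAddCommGroup K) (_ : InnerProductSpace ℂ K) (_ : CompleteSpace K)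
      (ι : H →ₗᵢ[ℂ] K) (U : K →L[ℂ] K),
      IsAnnulusUnitary r U ∧ ∀ h : H, U (ι h) = ι (V h)

/-!
Write `a n = ‖V ^ n h‖ ^ 2` for `n : ℤ`. Taken at the vector `V ^ n h`, either operator equation says
that `a (n + 1) - (1 + r ^ 2) * a n + r ^ 2 * a (n - 1) = 0`, a recurrence whose solutions are
`A + B * r ^ (2 * n)`.

If `U` is normal, the equation for `U` says by the continuous functional calculus that
`(‖z‖ ^ 2 - 1) * (‖z‖ ^ 2 - r ^ 2)` vanishes on the spectrum of `U`, that is, that the spectrum lies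
on the two boundary circles (`isAnnulusUnitary_iff`). Being a statement about norms of orbits
(`hereditary_eq_zero_iff`), the equation passes to restrictions of `U` to invariant subspaces.

Conversely, let an invertible `V` satisfy the equation. Since `A + B * r ^ (2 * n)` is nonnegative
for all integers `n`, both `A` and `B` are nonnegative (`le_norm_apply`, `norm_apply_le`); here
`(1 - r ^ 2) * A = ‖V h‖ ^ 2 - r ^ 2 * ‖h‖ ^ 2` and `(1 - r ^ 2) * B = ‖h‖ ^ 2 - ‖V h‖ ^ 2`. So `V` is
a contraction and so is `r V⁻¹`, which places the spectrum of `V` in the closed annulus. Moreover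
`A = ‖S h‖ ^ 2` and `B = ‖T h‖ ^ 2` for some operators `S` and `T`, with
`‖S h‖ ^ 2 + ‖T h‖ ^ 2 = ‖h‖ ^ 2`, `‖S V h‖ = ‖S h‖` and `‖T V h‖ = r * ‖T h‖`. As `V` is surjective, it
induces a unitary on the closure of the range of `S` and `r` times a unitary on the closure of the
range of `T` (`exists_unitary_intertwining`). The direct sum of these two operators is an annulus
unitary (`isAnnulusUnitary_of_prod`), and it extends `V` along the isometric embedding
`h ↦ (S h, T h)`.
-/

open ContinuousLinearMap

/-! ### The boundary of the annulus -/

/-- Every point of the closed annulus is a radial limit of points of the open one. -/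
lemma closure_annulus {r : ℝ} (hr0 : 0 < r) (hr1 : r < 1) :
    closure (annulus r) = {z : ℂ | r ≤ ‖z‖ ∧ ‖z‖ ≤ 1} := by
  apply subset_antisymm
  · refine closure_minimal (fun z hz => ⟨hz.1.le, hz.2.le⟩) ?_
    exact (isClosed_le continuous_const continuous_norm).inter
      (isClosed_le continuous_norm continuous_const)
  · rintro z ⟨h1, h2⟩
    have hz : ‖z‖ ≠ 0 := (hr0.trans_le h1).ne'
    have hc : ‖z‖ ∈ closure (Set.Ioo r 1) := by
      rw [closure_Ioo hr1.ne]; exact ⟨h1, h2⟩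
    have hf : Continuous fun t : ℝ => (t : ℂ) * (z / ‖z‖) := by fun_prop
    have := map_mem_closure (t := annulus r) hf hc (by
      rintro t ⟨ht1, ht2⟩
      have : ‖(t : ℂ) * (z / ‖z‖)‖ = t := by
        simp [hz, abs_of_pos (hr0.trans ht1)]
      simp only [annulus, Set.mem_ofPred_eq, this]
      exact ⟨ht1, ht2⟩)
    have hz' : (‖z‖ : ℂ) ≠ 0 := by exact_mod_cast hz
    simpa [mul_div_cancel₀ _ hz'] using this

lemma mem_frontier_annulus {r : ℝ} (hr0 : 0 < r) (hr1 : r < 1) (z : ℂ) :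
    z ∈ frontier (annulus r) ↔ (‖z‖ ^ 2 - 1) * (‖z‖ ^ 2 - r ^ 2) = 0 := by
  have ho : IsOpen (annulus r) :=
    (isOpen_lt continuous_const continuous_norm).inter (isOpen_lt continuous_norm continuous_const)
  have h0 := norm_nonneg z
  rw [frontier, ho.interior_eq, closure_annulus hr0 hr1, mul_eq_zero, sub_eq_zero, sub_eq_zero,
    sq_eq_sq₀ h0 hr0.le, pow_eq_one_iff_of_nonneg h0 two_ne_zero]
  simp only [annulus, Set.mem_sdiff, Set.mem_ofPred_eq]
  constructor
  · rintro ⟨⟨h1, h2⟩, h3⟩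
    by_contra! h
    exact h3 ⟨lt_of_le_of_ne h1 h.2.symm, lt_of_le_of_ne h2 h.1⟩
  · rintro (h | h) <;> simp [h, hr1.le]

/-! ### The operator equation as a recurrence for norms -/

/-- Two bounded operators on a complex Hilbert space with the same quadratic form are equal. -/
lemma clm_ext_inner {H : Type*} [NormedAddCommGroup H] [InnerProductSpace ℂ H] {S T : H →L[ℂ] H}
    (h : ∀ x, inner ℂ (S x) x = inner ℂ (T x) x) : S = T :=
  coe_injective ((ext_inner_map (S : H →ₗ[ℂ] H) T).1 h)

section Equation

variable {H : Type*} [NormedAddCommGroup H] [InnerProductSpace ℂ H] [CompleteSpace H]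

lemma inner_adjoint_mul_self (V : H →L[ℂ] H) (h : H) :
    inner ℂ ((adjoint V * V) h) h = ((‖V h‖ ^ 2 : ℝ) : ℂ) := by
  rw [mul_apply_eq_comp, adjoint_inner_left, inner_self_eq_norm_sq_to_K]
  simp

lemma hereditary_eq_zero_iff (r : ℝ) (V : H →L[ℂ] H) :
    -(adjoint V ^ 2 * V ^ 2) + (1 + (r : ℂ) ^ 2) • (adjoint V * V) - ((r : ℂ) ^ 2) • (1 : H →L[ℂ] H)
      = 0 ↔
    ∀ h, ‖V (V h)‖ ^ 2 - (1 + r ^ 2) * ‖V h‖ ^ 2 + r ^ 2 * ‖h‖ ^ 2 = 0 := by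
  have hsq : adjoint V ^ 2 * V ^ 2 = adjoint (V ^ 2) * V ^ 2 := by
    simp only [← star_eq_adjoint, star_pow]
  have key : ∀ h, inner ℂ ((-(adjoint V ^ 2 * V ^ 2) + (1 + (r : ℂ) ^ 2) • (adjoint V * V)
      - ((r : ℂ) ^ 2) • (1 : H →L[ℂ] H)) h) h
      = ((-(‖V (V h)‖ ^ 2 - (1 + r ^ 2) * ‖V h‖ ^ 2 + r ^ 2 * ‖h‖ ^ 2) : ℝ) : ℂ) := by
    intro h
    rw [hsq, sub_apply, add_apply, neg_apply, smul_apply, smul_apply, inner_sub_left,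
      inner_add_left, inner_neg_left, inner_smul_left, inner_smul_left, inner_adjoint_mul_self,
      inner_adjoint_mul_self, one_apply_eq_self, inner_self_eq_norm_sq_to_K, pow_two V,
      mul_apply_eq_comp]
    simp only [map_add, map_pow, map_one, Complex.conj_ofReal]
    push_cast
    simp only [Complex.coe_algebraMap]
    ring
  constructor
  · intro h x
    have := key x
    rw [h, zero_apply, inner_zero_left] at this
    have := Complex.ofReal_eq_zero.1 this.symm
    linarith
  · intro h
    refine clm_ext_inner fun x => ?_
    rw [key, h]
    simp

lemma add_adjoint_mul_inv_eq_iff (r : ℝ) (V : (H →L[ℂ] H)ˣ) :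
    adjoint (V : H →L[ℂ] H) * (V : H →L[ℂ] H)
        + adjoint ((r : ℂ) • ((V⁻¹ : (H →L[ℂ] H)ˣ) : H →L[ℂ] H))
          * ((r : ℂ) • ((V⁻¹ : (H →L[ℂ] H)ˣ) : H →L[ℂ] H))
        = (1 + (r : ℂ) ^ 2) • (1 : H →L[ℂ] H) ↔
    ∀ h, ‖(V : H →L[ℂ] H) ((V : H →L[ℂ] H) h)‖ ^ 2 - (1 + r ^ 2) * ‖(V : H →L[ℂ] H) h‖ ^ 2
      + r ^ 2 * ‖h‖ ^ 2 = 0 := by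
  set W := ((V⁻¹ : (H →L[ℂ] H)ˣ) : H →L[ℂ] H)
  have hVW : ∀ h, (V : H →L[ℂ] H) (W h) = h := fun h => DFunLike.congr_fun V.mul_inv h
  have hWV : ∀ h, W ((V : H →L[ℂ] H) h) = h := fun h => DFunLike.congr_fun V.inv_mul h
  have key1 : ∀ h, inner ℂ ((adjoint (V : H →L[ℂ] H) * (V : H →L[ℂ] H)
        + adjoint ((r : ℂ) • W) * ((r : ℂ) • W)) h) h
      = ((‖(V : H →L[ℂ] H) h‖ ^ 2 + r ^ 2 * ‖W h‖ ^ 2 : ℝ) : ℂ) := by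
    intro h
    rw [add_apply, inner_add_left, inner_adjoint_mul_self, inner_adjoint_mul_self, smul_apply,
      norm_smul, mul_pow]
    simp
  have key2 : ∀ h : H, inner ℂ (((1 + (r : ℂ) ^ 2) • (1 : H →L[ℂ] H)) h) h
      = (((1 + r ^ 2) * ‖h‖ ^ 2 : ℝ) : ℂ) := by
    intro h
    rw [smul_apply, inner_smul_left, one_apply_eq_self, inner_self_eq_norm_sq_to_K]
    simp
  constructor
  · intro h x
    have h1 := key1 ((V : H →L[ℂ] H) x)
    rw [h, key2, hWV] at h1
    have := Complex.ofReal_injective h1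
    linarith
  · intro h
    refine clm_ext_inner fun x => ?_
    have h1 := h (W x)
    rw [hVW] at h1
    rw [key1, key2]
    congr 1
    linarith

/-- Among normal operators, the annulus unitaries are the solutions of the operator equation. -/
lemma isAnnulusUnitary_iff {r : ℝ} (hr0 : 0 < r) (hr1 : r < 1) (U : H →L[ℂ] H) :
    IsAnnulusUnitary r U ↔ IsStarNormal U ∧
      ∀ h, ‖U (U h)‖ ^ 2 - (1 + r ^ 2) * ‖U h‖ ^ 2 + r ^ 2 * ‖h‖ ^ 2 = 0 := by
  refine and_congr_right fun hU => ?_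
  rw [← hereditary_eq_zero_iff]
  have hcfc : cfc (fun z : ℂ => -(star z ^ 2 * z ^ 2) + (1 + (r : ℂ) ^ 2) * (star z * z)
      - (r : ℂ) ^ 2) U = -(adjoint U ^ 2 * U ^ 2) + (1 + (r : ℂ) ^ 2) • (adjoint U * U)
        - ((r : ℂ) ^ 2) • (1 : H →L[ℂ] H) := by
    rw [cfc_sub _ _ U, cfc_add U _ _, cfc_neg _ U, cfc_mul _ _ U,
      cfc_const_mul (1 + (r : ℂ) ^ 2) _ U, cfc_mul _ _ U,
      cfc_pow _ 2 U, cfc_pow _ 2 U, cfc_star_id U, cfc_id' ℂ U, cfc_const ((r : ℂ) ^ 2) U,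
      Algebra.algebraMap_eq_smul_one, star_eq_adjoint]
  rw [← hcfc, ← cfc_zero ℂ U, cfc_eq_cfc_iff_eqOn]
  refine forall₂_congr fun z _ => ?_
  rw [mem_frontier_annulus hr0 hr1]
  have : -(star z ^ 2 * z ^ 2) + (1 + (r : ℂ) ^ 2) * (star z * z) - (r : ℂ) ^ 2
      = ((-((‖z‖ ^ 2 - 1) * (‖z‖ ^ 2 - r ^ 2)) : ℝ) : ℂ) := by
    have h : star z * z = ((‖z‖ ^ 2 : ℝ) : ℂ) := by
      simpa using Complex.conj_mul' z
    rw [← mul_pow, h]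
    push_cast
    ring
  simp only [this, Pi.zero_apply, Complex.ofReal_eq_zero, neg_eq_zero]

end Equation

/-! ### Positivity of the two coefficients -/

section Positivity

variable {H : Type*} [NormedAddCommGroup H] [InnerProductSpace ℂ H]

/-- The coefficient of the constant solution of the recurrence is nonnegative. -/
lemma le_norm_apply {r : ℝ} (hr0 : 0 < r) (hr1 : r < 1) {V : H →L[ℂ] H}
    (hV : ∀ h, ‖V (V h)‖ ^ 2 - (1 + r ^ 2) * ‖V h‖ ^ 2 + r ^ 2 * ‖h‖ ^ 2 = 0) (h : H) :
    r ^ 2 * ‖h‖ ^ 2 ≤ ‖V h‖ ^ 2 := by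
  -- The two coefficients along the forward orbit of `h`.
  have hn : ∀ n : ℕ, ‖V ((V ^ n) h)‖ ^ 2 - r ^ 2 * ‖(V ^ n) h‖ ^ 2 = ‖V h‖ ^ 2 - r ^ 2 * ‖h‖ ^ 2 ∧
      ‖(V ^ n) h‖ ^ 2 - ‖V ((V ^ n) h)‖ ^ 2 = (r ^ 2) ^ n * (‖h‖ ^ 2 - ‖V h‖ ^ 2) := by
    intro n
    induction n with
    | zero => simp
    | succ n ih =>
      rw [pow_succ' V, mul_apply_eq_comp, pow_succ' (r ^ 2), mul_assoc, ← ih.1, ← ih.2]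
      constructor <;> linarith [hV ((V ^ n) h)]
  have hlim : Filter.Tendsto (fun n : ℕ => (‖V h‖ ^ 2 - r ^ 2 * ‖h‖ ^ 2)
      + (r ^ 2) ^ n * (‖h‖ ^ 2 - ‖V h‖ ^ 2)) Filter.atTop
      (nhds ((‖V h‖ ^ 2 - r ^ 2 * ‖h‖ ^ 2) + 0 * (‖h‖ ^ 2 - ‖V h‖ ^ 2))) :=
    ((tendsto_pow_atTop_nhds_zero_of_lt_one (by positivity) (by nlinarith)).mul_const _).const_add _
  have := ge_of_tendsto' hlim (b := 0) fun n => by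
    rw [← (hn n).1, ← (hn n).2]
    have hr2 : 0 ≤ 1 - r ^ 2 := by nlinarith
    nlinarith [mul_nonneg hr2 (sq_nonneg ‖(V ^ n) h‖)]
  linarith

/-- The coefficient of the geometric solution of the recurrence is nonnegative. Surjectivity of
`V` is essential, since the proof follows backward orbits: the unilateral weighted shift with
`‖V ^ n e₀‖ ^ 2 = 2 - r ^ (2 * n)` satisfies the recurrence but is not a contraction. -/
lemma norm_apply_le {r : ℝ} (hr0 : 0 < r) (hr1 : r < 1) {V W : H →L[ℂ] H}
    (hVW : ∀ h, V (W h) = h)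
    (hV : ∀ h, ‖V (V h)‖ ^ 2 - (1 + r ^ 2) * ‖V h‖ ^ 2 + r ^ 2 * ‖h‖ ^ 2 = 0) (h : H) :
    ‖V h‖ ^ 2 ≤ ‖h‖ ^ 2 := by
  -- The two coefficients along the backward orbit of `h`, scaled by `r ^ (2 * n)` so that the
  -- second one is constant and the first one tends to `0`.
  have hn : ∀ n : ℕ, (r ^ 2) ^ n * (‖V ((W ^ n) h)‖ ^ 2 - r ^ 2 * ‖(W ^ n) h‖ ^ 2)
      = (r ^ 2) ^ n * (‖V h‖ ^ 2 - r ^ 2 * ‖h‖ ^ 2) ∧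
      (r ^ 2) ^ n * (‖(W ^ n) h‖ ^ 2 - ‖V ((W ^ n) h)‖ ^ 2) = ‖h‖ ^ 2 - ‖V h‖ ^ 2 := by
    intro n
    induction n with
    | zero => simp
    | succ n ih =>
      have h1 := hV (W ((W ^ n) h))
      rw [hVW] at h1
      rw [pow_succ' W, mul_apply_eq_comp, hVW, pow_succ' (r ^ 2), mul_assoc, mul_assoc,
        ← ih.1, ← ih.2]
      constructor
      · linear_combination (-(r ^ 2 * (r ^ 2) ^ n)) * h1
      · linear_combination ((r ^ 2) ^ n) * h1
  have hlim : Filter.Tendsto (fun n : ℕ => (r ^ 2) ^ n * (‖V h‖ ^ 2 - r ^ 2 * ‖h‖ ^ 2)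
      + (‖h‖ ^ 2 - ‖V h‖ ^ 2)) Filter.atTop
      (nhds (0 * (‖V h‖ ^ 2 - r ^ 2 * ‖h‖ ^ 2) + (‖h‖ ^ 2 - ‖V h‖ ^ 2))) :=
    ((tendsto_pow_atTop_nhds_zero_of_lt_one (by positivity) (by nlinarith)).mul_const _).add_const _
  have := ge_of_tendsto' hlim (b := 0) fun n => by
    rw [← (hn n).1, ← (hn n).2, ← mul_add]
    refine mul_nonneg (by positivity) ?_
    have hr2 : 0 ≤ 1 - r ^ 2 := by nlinarith
    nlinarith [mul_nonneg hr2 (sq_nonneg ‖(W ^ n) h‖)]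
  linarith

lemma exists_norm_sq_eq_of_nonneg [CompleteSpace H] (P : H →L[ℂ] H) (q : H → ℝ)
    (hq : ∀ h, inner ℂ (P h) h = (q h : ℂ)) (h0 : ∀ h, 0 ≤ q h) :
    ∃ S : H →L[ℂ] H, ∀ h, ‖S h‖ ^ 2 = q h := by
  have hP : 0 ≤ P := by
    rw [nonneg_iff_isPositive, isPositive_iff_complex]
    intro x
    rw [hq]
    simp [h0 x]
  obtain ⟨S, rfl⟩ := CStarAlgebra.nonneg_iff_eq_star_mul_self.1 hP
  refine ⟨S, fun h => ?_⟩
  have := hq h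
  rw [star_eq_adjoint, inner_adjoint_mul_self] at this
  exact Complex.ofReal_injective this

/-- A nonnegative linear combination of the forms `‖V h‖ ^ 2` and `‖h‖ ^ 2` is of the form
`‖S h‖ ^ 2`. -/
lemma exists_norm_sq_eq [CompleteSpace H] (V : H →L[ℂ] H) (a b : ℝ)
    (h0 : ∀ h, 0 ≤ a * ‖V h‖ ^ 2 + b * ‖h‖ ^ 2) :
    ∃ S : H →L[ℂ] H, ∀ h, ‖S h‖ ^ 2 = a * ‖V h‖ ^ 2 + b * ‖h‖ ^ 2 := by
  refine exists_norm_sq_eq_of_nonneg ((a : ℂ) • (adjoint V * V) + (b : ℂ) • (1 : H →L[ℂ] H)) _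
    (fun h => ?_) h0
  rw [add_apply, smul_apply, smul_apply, inner_add_left, inner_smul_left, inner_smul_left,
    inner_adjoint_mul_self, one_apply_eq_self, inner_self_eq_norm_sq_to_K]
  simp

end Positivity

/-! ### Construction of the normal extension -/

/-- A linear bijection `f` preserving the seminorm `h ↦ ‖S h‖` induces a unitary on the Hilbert
space completion for that seminorm, realized as the closure of the range of `S`. -/
lemma exists_unitary_intertwining {H : Type*} [NormedAddCommGroup H] [InnerProductSpace ℂ H]
    [CompleteSpace H] (S : H →L[ℂ] H) (f : H ≃ₗ[ℂ] H) (hf : ∀ h, ‖S (f h)‖ = ‖S h‖) :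
    ∃ (e : H →ₗ[ℂ] (LinearMap.range (S : H →ₗ[ℂ] H)).topologicalClosure)
      (W : (LinearMap.range (S : H →ₗ[ℂ] H)).topologicalClosure ≃ₗᵢ[ℂ]
        (LinearMap.range (S : H →ₗ[ℂ] H)).topologicalClosure),
      (∀ h, ‖e h‖ = ‖S h‖) ∧ ∀ h, W (e h) = e (f h) := by
  let e : H →ₗ[ℂ] (LinearMap.range (S : H →ₗ[ℂ] H)).topologicalClosure :=
    (S : H →ₗ[ℂ] H).codRestrict _ fun h =>
      Submodule.le_topologicalClosure _ (LinearMap.mem_range_self _ h)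
  have he : DenseRange e := by
    rintro ⟨x, hx⟩
    rw [closure_subtype, ← Set.range_comp]
    exact hx
  have hef : ∀ h, ‖e (f h)‖ = ‖e h‖ := hf
  exact ⟨e, f.extendOfIsometry e e he he hef, fun h => rfl, fun h =>
    f.extendOfIsometry_eq e e he he hef h⟩

/-- The direct sum of a unitary and `r` times a unitary is an annulus unitary. -/
lemma isAnnulusUnitary_of_prod {r : ℝ} (hr0 : 0 < r) (hr1 : r < 1) {K L : Type*}
    [NormedAddCommGroup K] [InnerProductSpace ℂ K] [CompleteSpace K]
    [NormedAddCommGroup L] [InnerProductSpace ℂ L] [CompleteSpace L]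
    (A : K ≃ₗᵢ[ℂ] K) (B : L ≃ₗᵢ[ℂ] L) (U : WithLp 2 (K × L) →L[ℂ] WithLp 2 (K × L))
    (hU : ∀ x, U x = WithLp.toLp 2 (A x.fst, (r : ℂ) • B x.snd)) : IsAnnulusUnitary r U := by
  rw [isAnnulusUnitary_iff hr0 hr1]
  have hnorm : ∀ x, ‖U x‖ ^ 2 = ‖x.fst‖ ^ 2 + r ^ 2 * ‖x.snd‖ ^ 2 := by
    intro x
    rw [WithLp.prod_norm_sq_eq_of_L2, hU]
    simp [norm_smul, mul_pow]
  constructor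
  · have hadj : ∀ y, adjoint U y = WithLp.toLp 2 (A.symm y.fst, (r : ℂ) • B.symm y.snd) := by
      intro y
      refine ext_inner_left ℂ fun x => ?_
      rw [adjoint_inner_right, hU, WithLp.prod_inner_apply, WithLp.prod_inner_apply]
      simp only [inner_smul_left, inner_smul_right, Complex.conj_ofReal]
      rw [← A.inner_map_map x.ofLp.1, ← B.inner_map_map x.ofLp.2]
      simp
    rw [isStarNormal_iff_norm_eq_adjoint]
    intro x
    rw [← sq_eq_sq₀ (norm_nonneg _) (norm_nonneg _), hnorm, WithLp.prod_norm_sq_eq_of_L2, hadj]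
    simp [norm_smul, mul_pow]
  · intro x
    rw [hnorm, hnorm, WithLp.prod_norm_sq_eq_of_L2 x, hU]
    simp only [WithLp.toLp_fst, WithLp.toLp_snd, LinearIsometryEquiv.norm_map, norm_smul, mul_pow,
      Complex.norm_real, Real.norm_eq_abs, sq_abs]
    ring

lemma exists_annulusUnitary_extension.{u} {H : Type u} [NormedAddCommGroup H]
    [InnerProductSpace ℂ H] [CompleteSpace H] {r : ℝ} (hr0 : 0 < r) (hr1 : r < 1)
    (V : (H →L[ℂ] H)ˣ)
    (hV : ∀ h, ‖(V : H →L[ℂ] H) ((V : H →L[ℂ] H) h)‖ ^ 2 - (1 + r ^ 2) * ‖(V : H →L[ℂ] H) h‖ ^ 2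
      + r ^ 2 * ‖h‖ ^ 2 = 0) :
    ∃ (K : Type u) (_ : NormedAddCommGroup K) (_ : InnerProductSpace ℂ K) (_ : CompleteSpace K)
      (ι : H →ₗᵢ[ℂ] K) (U : K →L[ℂ] K),
      IsAnnulusUnitary r U ∧ ∀ h : H, U (ι h) = ι ((V : H →L[ℂ] H) h) := by
  have hVW : ∀ h, (V : H →L[ℂ] H) (((V⁻¹ : (H →L[ℂ] H)ˣ) : H →L[ℂ] H) h) = h :=
    fun h => DFunLike.congr_fun V.mul_inv h
  have hr2 : 0 < 1 - r ^ 2 := by nlinarith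
  have hrc : (r : ℂ) ≠ 0 := by exact_mod_cast hr0.ne'
  obtain ⟨S, hS⟩ := exists_norm_sq_eq (V : H →L[ℂ] H) (1 / (1 - r ^ 2)) (-r ^ 2 / (1 - r ^ 2))
    fun h => by
      have := le_norm_apply hr0 hr1 hV h
      have : 0 ≤ (‖(V : H →L[ℂ] H) h‖ ^ 2 - r ^ 2 * ‖h‖ ^ 2) / (1 - r ^ 2) :=
        div_nonneg (by linarith) hr2.le
      convert! this using 1
      ring
  obtain ⟨T, hT⟩ := exists_norm_sq_eq (V : H →L[ℂ] H) (-1 / (1 - r ^ 2)) (1 / (1 - r ^ 2))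
    fun h => by
      have := norm_apply_le hr0 hr1 hVW hV h
      have : 0 ≤ (‖h‖ ^ 2 - ‖(V : H →L[ℂ] H) h‖ ^ 2) / (1 - r ^ 2) :=
        div_nonneg (by linarith) hr2.le
      convert! this using 1
      ring
  have hSV : ∀ h, ‖S ((V : H →L[ℂ] H) h)‖ = ‖S h‖ := fun h => by
    rw [← sq_eq_sq₀ (norm_nonneg _) (norm_nonneg _), hS, hS]
    linear_combination (1 / (1 - r ^ 2)) * hV h
  have hTV : ∀ h, ‖T ((V : H →L[ℂ] H) h)‖ = r * ‖T h‖ := fun h => by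
    rw [← sq_eq_sq₀ (norm_nonneg _) (by positivity), mul_pow, hT, hT]
    linear_combination (-1 / (1 - r ^ 2)) * hV h
  let f : H ≃ₗ[ℂ] H := (ContinuousLinearEquiv.ofUnit V).toLinearEquiv
  let g : H ≃ₗ[ℂ] H := f.trans (LinearEquiv.smulOfNeZero ℂ H (r : ℂ)⁻¹ (inv_ne_zero hrc))
  have hf : ∀ h, f h = (V : H →L[ℂ] H) h := fun h => rfl
  have hg : ∀ h, g h = (r : ℂ)⁻¹ • (V : H →L[ℂ] H) h := fun h => rfl
  obtain ⟨s, A, hs, hA⟩ := exists_unitary_intertwining S f hSV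
  obtain ⟨t, B, ht, hB⟩ := exists_unitary_intertwining T g fun h => by
    rw [hg, map_smul, norm_smul, hTV, norm_inv, Complex.norm_real, Real.norm_of_nonneg hr0.le,
      inv_mul_cancel_left₀ hr0.ne']
  let ι : H →ₗᵢ[ℂ] WithLp 2 ((LinearMap.range (S : H →ₗ[ℂ] H)).topologicalClosure ×
      (LinearMap.range (T : H →ₗ[ℂ] H)).topologicalClosure) :=
    { toLinearMap := (WithLp.linearEquiv 2 ℂ _).symm.toLinearMap ∘ₗ s.prod t
      norm_map' := fun h => by
        have : ‖WithLp.toLp 2 (s h, t h)‖ ^ 2 = ‖h‖ ^ 2 := by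
          rw [WithLp.prod_norm_sq_eq_of_L2]
          change ‖s h‖ ^ 2 + ‖t h‖ ^ 2 = _
          rw [hs, ht, hS, hT]
          field_simp
          ring
        exact (sq_eq_sq₀ (norm_nonneg _) (norm_nonneg _)).1 this }
  have hι : ∀ h, ι h = WithLp.toLp 2 (s h, t h) := fun h => rfl
  let e := WithLp.prodContinuousLinearEquiv 2 ℂ (LinearMap.range (S : H →ₗ[ℂ] H)).topologicalClosure
    (LinearMap.range (T : H →ₗ[ℂ] H)).topologicalClosure
  let U := e.symm.toContinuousLinearMap ∘L
    (A.toContinuousLinearEquiv.toContinuousLinearMap.prodMap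
      ((r : ℂ) • B.toContinuousLinearEquiv.toContinuousLinearMap)) ∘L e.toContinuousLinearMap
  have hU : ∀ x, U x = WithLp.toLp 2 (A x.fst, (r : ℂ) • B x.snd) := fun x => rfl
  refine ⟨_, inferInstance, inferInstance, inferInstance, ι, U,
    isAnnulusUnitary_of_prod hr0 hr1 A B U hU, fun h => ?_⟩
  rw [hU, hι, hι]
  change WithLp.toLp 2 (A (s h), (r : ℂ) • B (t h)) = _
  rw [hA, hB, hf, hg, map_smul, smul_inv_smul₀ hrc]

/-! ### The characterization -/

lemma spectrum_subset_closure_annulus {H : Type*} [NormedAddCommGroup H] [InnerProductSpace ℂ H]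
    [CompleteSpace H] {r : ℝ} (hr0 : 0 < r) (hr1 : r < 1) (V : (H →L[ℂ] H)ˣ)
    (h1 : ‖(V : H →L[ℂ] H)‖ ≤ 1) (h2 : ‖((V⁻¹ : (H →L[ℂ] H)ˣ) : H →L[ℂ] H)‖ ≤ r⁻¹) :
    spectrum ℂ (V : H →L[ℂ] H) ⊆ closure (annulus r) := by
  rw [closure_annulus hr0 hr1]
  -- The algebra of operators on a trivial space is not a `NormOneClass`.
  have hle : ∀ (T : H →L[ℂ] H) (z : ℂ), z ∈ spectrum ℂ T → ‖z‖ ≤ ‖T‖ := fun T z hz =>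
    (spectrum.norm_le_norm_mul_of_mem hz).trans
      (mul_le_of_le_one_right (norm_nonneg _) norm_id_le)
  intro z hz
  have hz0 : z ≠ 0 := by
    rintro rfl
    exact spectrum.zero_notMem ℂ V.isUnit hz
  refine ⟨?_, (hle _ z hz).trans h1⟩
  have := (hle _ _ (spectrum.inv₀_mem_inv_iff.2 hz)).trans h2
  rw [norm_inv] at this
  exact (inv_le_inv₀ (norm_pos_iff.2 hz0) hr0).1 this

lemma isAnnulusIsometry_iff {H : Type*} [NormedAddCommGroup H] [InnerProductSpace ℂ H]
    [CompleteSpace H] {r : ℝ} (hr0 : 0 < r) (hr1 : r < 1) (V : (H →L[ℂ] H)ˣ) :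
    IsAnnulusIsometry r (V : H →L[ℂ] H) ↔
      ∀ h, ‖(V : H →L[ℂ] H) ((V : H →L[ℂ] H) h)‖ ^ 2 - (1 + r ^ 2) * ‖(V : H →L[ℂ] H) h‖ ^ 2
        + r ^ 2 * ‖h‖ ^ 2 = 0 := by
  constructor
  · rintro ⟨-, K, _, _, _, ι, U, hU, hι⟩ h
    have := ((isAnnulusUnitary_iff hr0 hr1 U).1 hU).2 (ι h)
    simpa only [hι, ι.norm_map] using this
  · intro hV
    have hVW : ∀ h, (V : H →L[ℂ] H) (((V⁻¹ : (H →L[ℂ] H)ˣ) : H →L[ℂ] H) h) = h :=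
      fun h => DFunLike.congr_fun V.mul_inv h
    refine ⟨spectrum_subset_closure_annulus hr0 hr1 V ?_ ?_,
      exists_annulusUnitary_extension hr0 hr1 V hV⟩
    · refine opNorm_le_bound _ zero_le_one fun h => ?_
      rw [one_mul]
      exact (sq_le_sq₀ (norm_nonneg _) (norm_nonneg _)).1 (norm_apply_le hr0 hr1 hVW hV h)
    · refine opNorm_le_bound _ (by positivity) fun h => ?_
      have := le_norm_apply hr0 hr1 hV (((V⁻¹ : (H →L[ℂ] H)ˣ) : H →L[ℂ] H) h)
      rw [hVW, ← mul_pow, sq_le_sq₀ (by positivity) (norm_nonneg _)] at this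
      rwa [le_inv_mul_iff₀ hr0]

theorem mainTheorem4 {H : Type*} [NormedAddCommGroup H] [InnerProductSpace ℂ H] [CompleteSpace H]
    (r : ℝ) (hr0 : 0 < r) (hr1 : r < 1) (V : (H →L[ℂ] H)ˣ) :
    (IsAnnulusIsometry r (V : H →L[ℂ] H) ↔
      -(ContinuousLinearMap.adjoint (V : H →L[ℂ] H) ^ 2 * (V : H →L[ℂ] H) ^ 2)
        + (1 + (r : ℂ) ^ 2) • (ContinuousLinearMap.adjoint (V : H →L[ℂ] H) * (V : H →L[ℂ] H))
        - ((r : ℂ) ^ 2) • (1 : H →L[ℂ] H) = 0) ∧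
    (IsAnnulusIsometry r (V : H →L[ℂ] H) ↔
      ContinuousLinearMap.adjoint (V : H →L[ℂ] H) * (V : H →L[ℂ] H)
        + ContinuousLinearMap.adjoint ((r : ℂ) • ((V⁻¹ : (H →L[ℂ] H)ˣ) : H →L[ℂ] H))
          * ((r : ℂ) • ((V⁻¹ : (H →L[ℂ] H)ˣ) : H →L[ℂ] H))
        = (1 + (r : ℂ) ^ 2) • (1 : H →L[ℂ] H)) := by
  exact ⟨(isAnnulusIsometry_iff hr0 hr1 V).trans (hereditary_eq_zero_iff r _).symm,
    (isAnnulusIsometry_iff hr0 hr1 V).trans (add_adjoint_mul_inv_eq_iff r V).symm⟩
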